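/- Let $M>0$ and let the Kruskal extension of the Schwarzschild spacetime of mass $M$ be described by the coordinates $(T,X)$ with $X^2-T^2>-2M$ (times the sphere), where the area radius $r=r(T,X)>0$ is the unique positive solution of $(r-2M)e^{r/(2M)}=X^2-T^2$. For $H\in\mathbb R$, a spacelike, spherically symmetric, constant mean curvature (SS-CMC) hypersurface is a graph $T=F(X)$, $X\in I$, in the Kruskal extension, where $I\subseteq\mathbb R$ is an interval with more than one point and $F\in C^2(I)$ satisfies on $I$ the spacelike condition $1-F'(X)^2>0$ and, with $r=r(F(X),X)$, the SS-CMC equation $$F''(X)+e^{-\frac{r}{2M}}\left(\frac{6M}{r^2}-\frac1r\right)\bigl(-F(X)+F'(X)X\bigr)\bigl(1-F'(X)^2\bigr)+\frac{12HM\,e^{-\frac{r}{4M}}}{\sqrt r}\bigl(1-F'(X)^2\bigr)^{3/2}=0 .$$ (Derivatives are one-sided at endpoints that belong to $I$.) It solves the symmetric Dirichlet problem $(\star)$ with boundary data $(T_0,X_0)$, $(T_0,-X_0)$, $X_0\neq0$, if $\pm X_0\in I$ and $F(X_0)=F(-X_0)=T_0$. Theorem. For all $M>0$ and $H,T_0,X_0\in\mathbb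 R$ with $X_0\ne0$, every SS-CMC hypersurface $T=F(X)$, $X\in I$, solving $(\star)$ is $T$-axisymmetric: $F(-X)=F(X)$ for all $X\in I$ with $-X\in I$. If moreover the hypersurface is inextendible (it is not a proper part of an SS-CMC graph over a larger interval with the same $M$ and $H$), then $I=-I$, so that $F(-X)=F(X)$ for all $X\in I$. -/

import Mathlib

noncomputable section

namespace Kruskal

/-- The function `r ↦ (r - 2M) e^{r/(2M)}`, which relates the area radius `r` to the Kruskal
coordinates through `(r - 2M) e^{r/(2M)} = X² - T²`. -/
def radialFun (M r : ℝ) : ℝ := (r - 2 * M) * Real.exp (r / (2 * M))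

theorem radialFun_strictMonoOn {M : ℝ} (hM : 0 < M) :
    StrictMonoOn (radialFun M) (Set.Ici 0) := by
  have hd : ∀ r : ℝ, HasDerivAt (radialFun M) (r / (2 * M) * Real.exp (r / (2 * M))) r := by
    intro r
    have h1 : HasDerivAt (fun r : ℝ => r - 2 * M) 1 r := (hasDerivAt_id r).sub_const _
    have h2 : HasDerivAt (fun r : ℝ => Real.exp (r / (2 * M)))
        (Real.exp (r / (2 * M)) * (1 / (2 * M))) r :=
      ((hasDerivAt_id r).div_const (2 * M)).exp
    have h3 := h1.mul h2
    refine h3.congr_deriv ?_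
    field_simp
    ring
  refine strictMonoOn_of_deriv_pos (convex_Ici 0) (fun r _ => (hd r).continuousAt.continuousWithinAt) ?_
  intro r hr
  rw [interior_Ici] at hr
  have hr' : 0 < r := hr
  rw [(hd r).deriv]
  positivity

theorem existsUnique_radius {M : ℝ} (hM : 0 < M) {y : ℝ} (hy : -(2 * M) < y) :
    ∃! r : ℝ, 0 < r ∧ radialFun M r = y := by
  have hmono := radialFun_strictMonoOn hM
  have h0 : radialFun M 0 = -(2 * M) := by simp [radialFun]
  set b : ℝ := 2 * M + |y| with hb
  have hb0 : 0 ≤ b := by positivity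
  have hby : y ≤ radialFun M b := by
    have h1 : (1 : ℝ) ≤ Real.exp (b / (2 * M)) := Real.one_le_exp (by positivity)
    have h2 : radialFun M b = |y| * Real.exp (b / (2 * M)) := by simp [radialFun, hb]
    rw [h2]
    nlinarith [abs_nonneg y, le_abs_self y]
  have hc : ContinuousOn (radialFun M) (Set.Icc 0 b) := by
    unfold radialFun
    fun_prop
  obtain ⟨r, hr, hry⟩ := intermediate_value_Icc hb0 hc ⟨by rw [h0]; exact hy.le, hby⟩
  have hr0 : r ≠ 0 := by
    rintro rfl
    rw [h0] at hry
    exact absurd hry hy.ne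
  refine ⟨r, ⟨lt_of_le_of_ne hr.1 hr0.symm, hry⟩, ?_⟩
  rintro s ⟨hs, hsy⟩
  exact hmono.injOn (Set.mem_Ici.2 hs.le) (Set.mem_Ici.2 hr.1) (hsy.trans hry.symm)

open Classical in
/-- The area radius `r = r(T, X)` on the Kruskal extension `{X² - T² > -2M}`: the unique `r > 0`
with `(r - 2M) e^{r/(2M)} = X² - T²` (the value is irrelevant outside the Kruskal extension). -/
def radius (M T X : ℝ) : ℝ :=
  if h : ∃ r : ℝ, 0 < r ∧ radialFun M r = X ^ 2 - T ^ 2 then h.choose else 0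

theorem radius_spec {M T X : ℝ} (hM : 0 < M) (h : -(2 * M) < X ^ 2 - T ^ 2) :
    0 < radius M T X ∧ radialFun M (radius M T X) = X ^ 2 - T ^ 2 := by
  have he := (existsUnique_radius hM h).exists
  rw [radius, dif_pos he]
  exact he.choose_spec

theorem radius_eq {M T X r : ℝ} (hM : 0 < M) (h : -(2 * M) < X ^ 2 - T ^ 2)
    (hr : 0 < r) (hr' : radialFun M r = X ^ 2 - T ^ 2) : radius M T X = r :=
  (existsUnique_radius hM h).unique (radius_spec hM h) ⟨hr, hr'⟩

/-- The left-hand side of the constant mean curvature equation at a point `X` for a spherically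
symmetric graph `T = F(X)`, with `T = F(X)`, `p = F'(X)`, `q = F''(X)`. -/
def cmcExpr (M H X T p q : ℝ) : ℝ :=
  q + Real.exp (-(radius M T X / (2 * M)))
        * (6 * M / (radius M T X) ^ 2 - 1 / radius M T X) * (-T + p * X) * (1 - p ^ 2)
    + 12 * H * M * Real.exp (-(radius M T X / (4 * M))) / Real.sqrt (radius M T X)
        * (1 - p ^ 2) ^ (3 / 2 : ℝ)

/-- The graph `T = F(X)`, `X ∈ I`, is a spacelike, spherically symmetric hypersurface of constant
mean curvature `H` in the Kruskal extension of mass `M`. Here `I` is an interval with more than one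
point; at an endpoint that belongs to `I` derivatives are one-sided. -/
structure IsSSCMC (M H : ℝ) (I : Set ℝ) (F : ℝ → ℝ) : Prop where
  ordConnected : I.OrdConnected
  nontrivial : I.Nontrivial
  contDiffOn : ContDiffOn ℝ 2 F I
  mem_kruskal : ∀ X ∈ I, -(2 * M) < X ^ 2 - (F X) ^ 2
  spacelike : ∀ X ∈ I, 0 < 1 - (derivWithin F I X) ^ 2
  equation : ∀ X ∈ I,
    cmcExpr M H X (F X) (derivWithin F I X) (derivWithin (derivWithin F I) I X) = 0

/-- The graph of `F` over `I` solves the Dirichlet problem with symmetric boundary data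
`(T₀, X₀)`, `(T₀, -X₀)`. -/
structure SolvesDirichlet (M H T₀ X₀ : ℝ) (I : Set ℝ) (F : ℝ → ℝ) : Prop where
  isSSCMC : IsSSCMC M H I F
  mem_right : X₀ ∈ I
  mem_left : -X₀ ∈ I
  right_value : F X₀ = T₀
  left_value : F (-X₀) = T₀

/-- The hypersurface `T = F(X)`, `X ∈ I`, is inextendible: it is not a proper part of another graph
of the same kind (with the same `M` and `H`). -/
def IsInextendible (M H : ℝ) (I : Set ℝ) (F : ℝ → ℝ) : Prop :=
  IsSSCMC M H I F ∧
    ∀ (J : Set ℝ) (G : ℝ → ℝ), IsSSCMC M H J G → I ⊆ J → Set.EqOn G F I → J = I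

/-- The graph `T = F(X)`, `X ∈ I`, is invariant under `X ↦ -X`. -/
def IsTAxisymmetric (I : Set ℝ) (F : ℝ → ℝ) : Prop :=
  ∀ X ∈ I, -X ∈ I ∧ F (-X) = F X

end Kruskal

end

/-! The Killing field `X ∂_T + T ∂_X` gives the equation a first integral, `flux`: a positive
function of `r` times the boosted slope `(T - X p) / √(1 - p²)`, minus `H r³`. Points `(T, ±a)` have
the same radius, so `p = F'(a)` and `q = -F'(-a)` have equal boosted slopes at `(T, a)`. Once `p =
q` is known, the graph and its mirror image share Cauchy data at `a`, and ODE uniqueness makes them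
agree.

If `|T| ≤ a`, the boosted slope is injective in `p`. If `T > a`, it only fixes `(a - T p) / √(1 -
p²)` up to sign (`boost_sq`). The wrong sign would make `r` increase at both ends, or decrease at
both, and hence have critical points above and below its end value. There the flux equals `V(r) =
√(r³ (2M - r)) - H r³`, while at `a` it is strictly larger than `V`. This contradicts quasiconcavity
of `V` (`mul_nonpos_of_lt`). Time reversal, with `H` replaced by `-H`, covers `T < -a`.

For inextendible graphs, the symmetric graph and its mirror image glue over `I ∪ -I`, which must
therefore be `I`. -/

open Set Filter Topology

namespace Kruskal

/-! ### ODE uniqueness, critical points and elementary inequalities -/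

section Calculus

theorem lipschitzOnWith_phase {Φ : ℝ × ℝ × ℝ → ℝ} {K : NNReal} {S : Set (ℝ × ℝ × ℝ)}
    (hK : LipschitzOnWith K Φ S) (t : ℝ) :
    LipschitzOnWith (max 1 K) (fun y : ℝ × ℝ => (y.2, Φ (t, y))) {y | (t, y) ∈ S} := by
  refine LipschitzOnWith.prodMk LipschitzWith.prod_snd.lipschitzOnWith ?_
  have h := hK.comp (LipschitzWith.prodMk_left t).lipschitzOnWith
    (fun y (hy : y ∈ {y : ℝ × ℝ | (t, y) ∈ S}) => hy)
  rw [mul_one] at h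
  exact h

/-- The right-hand side is regular only near the spacelike Kruskal phase points, so no global
Lipschitz bound is available. Compactness gives one on the union of the two trajectories, which is
all that uniqueness requires. -/
theorem exists_lipschitzOnWith_trajectory {Φ : ℝ × ℝ × ℝ → ℝ} {f f' g g' : ℝ → ℝ} {a b : ℝ}
    (hf : ContinuousOn f (Icc a b)) (hf' : ContinuousOn f' (Icc a b))
    (hg : ContinuousOn g (Icc a b)) (hg' : ContinuousOn g' (Icc a b))
    (hΦf : ∀ x ∈ Icc a b, ContDiffAt ℝ 1 Φ (x, f x, f' x))
    (hΦg : ∀ x ∈ Icc a b, ContDiffAt ℝ 1 Φ (x, g x, g' x)) :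
    ∃ K, LipschitzOnWith K Φ
      ((fun x => (x, f x, f' x)) '' Icc a b ∪ (fun x => (x, g x, g' x)) '' Icc a b) := by
  refine LocallyLipschitzOn.exists_lipschitzOnWith_of_compact
    ((isCompact_Icc.image_of_continuousOn (continuousOn_id.prodMk (hf.prodMk hf'))).union
      (isCompact_Icc.image_of_continuousOn (continuousOn_id.prodMk (hg.prodMk hg')))) ?_
  have key : ∀ z, ContDiffAt ℝ 1 Φ z → ∀ S : Set (ℝ × ℝ × ℝ),
      ∃ K : NNReal, ∃ t ∈ 𝓝[S] z, LipschitzOnWith K Φ t := by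
    intro z hz S
    obtain ⟨K, t, ht, h⟩ := hz.exists_lipschitzOnWith
    exact ⟨K, t, mem_nhdsWithin_of_mem_nhds ht, h⟩
  rintro z (⟨x, hx, rfl⟩ | ⟨x, hx, rfl⟩)
  · exact key _ (hΦf x hx) _
  · exact key _ (hΦg x hx) _

/-- Uniqueness for the second-order equation `f'' = Φ(x, f, f')` on a compact interval. -/
theorem eqOn_of_secondOrder {Φ : ℝ × ℝ × ℝ → ℝ} {f f' g g' : ℝ → ℝ} {a b t : ℝ}
    (ht : t = a ∨ t = b)
    (hf : ∀ x ∈ Icc a b, HasDerivWithinAt f (f' x) (Icc a b) x)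
    (hf' : ∀ x ∈ Icc a b, HasDerivWithinAt f' (Φ (x, f x, f' x)) (Icc a b) x)
    (hg : ∀ x ∈ Icc a b, HasDerivWithinAt g (g' x) (Icc a b) x)
    (hg' : ∀ x ∈ Icc a b, HasDerivWithinAt g' (Φ (x, g x, g' x)) (Icc a b) x)
    (hΦf : ∀ x ∈ Icc a b, ContDiffAt ℝ 1 Φ (x, f x, f' x))
    (hΦg : ∀ x ∈ Icc a b, ContDiffAt ℝ 1 Φ (x, g x, g' x))
    (h0 : f t = g t) (h1 : f' t = g' t) : EqOn f g (Icc a b) := by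
  have cf : ContinuousOn f (Icc a b) := fun x hx => (hf x hx).continuousWithinAt
  have cf' : ContinuousOn f' (Icc a b) := fun x hx => (hf' x hx).continuousWithinAt
  have cg : ContinuousOn g (Icc a b) := fun x hx => (hg x hx).continuousWithinAt
  have cg' : ContinuousOn g' (Icc a b) := fun x hx => (hg' x hx).continuousWithinAt
  obtain ⟨K, hK⟩ := exists_lipschitzOnWith_trajectory cf cf' cg cg' hΦf hΦg
  have hfd : ∀ x ∈ Icc a b, HasDerivWithinAt (fun x => (f x, f' x)) (f' x, Φ (x, f x, f' x))
      (Icc a b) x := fun x hx => (hf x hx).prodMk (hf' x hx)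
  have hgd : ∀ x ∈ Icc a b, HasDerivWithinAt (fun x => (g x, g' x)) (g' x, Φ (x, g x, g' x))
      (Icc a b) x := fun x hx => (hg x hx).prodMk (hg' x hx)
  have heq : (fun x => (f x, f' x)) t = (fun x => (g x, g' x)) t := Prod.ext h0 h1
  have main : EqOn (fun x => (f x, f' x)) (fun x => (g x, g' x)) (Icc a b) := by
    rcases ht with rfl | rfl
    · refine ODE_solution_unique_of_mem_Icc_right (K := max 1 K)
        (v := fun x y => (y.2, Φ (x, y))) (fun x _ => lipschitzOnWith_phase hK x)
        (cf.prodMk cf') ?_ ?_ (cg.prodMk cg') ?_ ?_ heq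
      · exact fun x hx => (hfd x (Ico_subset_Icc_self hx)).mono_of_mem_nhdsWithin
          (Icc_mem_nhdsGE_of_mem hx)
      · exact fun x hx => Or.inl ⟨x, Ico_subset_Icc_self hx, rfl⟩
      · exact fun x hx => (hgd x (Ico_subset_Icc_self hx)).mono_of_mem_nhdsWithin
          (Icc_mem_nhdsGE_of_mem hx)
      · exact fun x hx => Or.inr ⟨x, Ico_subset_Icc_self hx, rfl⟩
    · refine ODE_solution_unique_of_mem_Icc_left (K := max 1 K)
        (v := fun x y => (y.2, Φ (x, y))) (fun x _ => lipschitzOnWith_phase hK x)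
        (cf.prodMk cf') ?_ ?_ (cg.prodMk cg') ?_ ?_ heq
      · exact fun x hx => (hfd x (Ioc_subset_Icc_self hx)).mono_of_mem_nhdsWithin
          (Icc_mem_nhdsLE_of_mem hx)
      · exact fun x hx => Or.inl ⟨x, Ioc_subset_Icc_self hx, rfl⟩
      · exact fun x hx => (hgd x (Ioc_subset_Icc_self hx)).mono_of_mem_nhdsWithin
          (Icc_mem_nhdsLE_of_mem hx)
      · exact fun x hx => Or.inr ⟨x, Ioc_subset_Icc_self hx, rfl⟩
  exact fun x hx => congrArg Prod.fst (main hx)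

theorem exists_gt_left_of_deriv_pos {R : ℝ → ℝ} {a b d : ℝ} (hab : a < b) (hd : 0 < d)
    (h : HasDerivWithinAt R d (Icc a b) a) : ∃ y ∈ Icc a b, R a < R y := by
  have h1 : HasDerivWithinAt R d (Ioi a) a :=
    h.mono_of_mem_nhdsWithin (mem_of_superset (Ioo_mem_nhdsGT hab) Ioo_subset_Icc_self)
  rw [hasDerivWithinAt_iff_tendsto_slope' (by simp)] at h1
  obtain ⟨y, hy, hy'⟩ :=
    ((h1.eventually (lt_mem_nhds hd)).and (Ioo_mem_nhdsGT hab)).exists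
  refine ⟨y, Ioo_subset_Icc_self hy', ?_⟩
  rw [slope_def_field] at hy
  have := (div_pos_iff_of_pos_right (sub_pos.2 hy'.1)).1 hy
  linarith

theorem exists_lt_right_of_deriv_pos {R : ℝ → ℝ} {a b d : ℝ} (hab : a < b) (hd : 0 < d)
    (h : HasDerivWithinAt R d (Icc a b) b) : ∃ y ∈ Icc a b, R y < R b := by
  have h1 : HasDerivWithinAt R d (Iio b) b :=
    h.mono_of_mem_nhdsWithin (mem_of_superset (Ioo_mem_nhdsLT hab) Ioo_subset_Icc_self)
  rw [hasDerivWithinAt_iff_tendsto_slope' (by simp)] at h1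
  obtain ⟨y, hy, hy'⟩ :=
    ((h1.eventually (lt_mem_nhds hd)).and (Ioo_mem_nhdsLT hab)).exists
  refine ⟨y, Ioo_subset_Icc_self hy', ?_⟩
  rw [slope_comm, slope_def_field] at hy
  have := (div_pos_iff_of_pos_right (sub_pos.2 hy'.2)).1 hy
  linarith

theorem exists_critical_ge {R R' : ℝ → ℝ} {a b : ℝ}
    (h : ∀ x ∈ Icc a b, HasDerivWithinAt R (R' x) (Icc a b) x) (hR : R a = R b)
    (hy : ∃ y ∈ Icc a b, R a < R y) : ∃ x ∈ Icc a b, R' x = 0 ∧ R a ≤ R x := by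
  obtain ⟨y, hy, hay⟩ := hy
  obtain ⟨x, hx, hmax⟩ := isCompact_Icc.exists_isMaxOn ⟨y, hy⟩
    (fun x hx => (h x hx).continuousWithinAt)
  have hxy : R y ≤ R x := hmax hy
  have hxa : x ≠ a := by rintro rfl; linarith
  have hxb : x ≠ b := by rintro rfl; linarith
  have hn : Icc a b ∈ 𝓝 x :=
    Icc_mem_nhds (lt_of_le_of_ne hx.1 hxa.symm) (lt_of_le_of_ne hx.2 hxb)
  exact ⟨x, hx, (hmax.isLocalMax hn).hasDerivAt_eq_zero ((h x hx).hasDerivAt hn),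
    (hay.trans_le hxy).le⟩

/-- If `R` takes equal values at the endpoints and is increasing there, it has critical points both
above and below this value. -/
theorem exists_critical_of_deriv_pos {R R' : ℝ → ℝ} {a b : ℝ} (hab : a < b)
    (h : ∀ x ∈ Icc a b, HasDerivWithinAt R (R' x) (Icc a b) x) (hR : R a = R b)
    (ha : 0 < R' a) (hb : 0 < R' b) :
    (∃ x ∈ Icc a b, R' x = 0 ∧ R a ≤ R x) ∧ ∃ x ∈ Icc a b, R' x = 0 ∧ R x ≤ R a := by
  refine ⟨exists_critical_ge h hR
    (exists_gt_left_of_deriv_pos hab ha (h a (left_mem_Icc.2 hab.le))), ?_⟩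
  obtain ⟨y, hy, hyb⟩ := exists_lt_right_of_deriv_pos hab hb (h b (right_mem_Icc.2 hab.le))
  obtain ⟨x, hx, hx0, hxa⟩ := exists_critical_ge (R := fun x => -R x) (R' := fun x => -R' x)
    (fun x hx => (h x hx).neg) (by simp [hR]) ⟨y, hy, by linarith⟩
  exact ⟨x, hx, by linarith, by linarith⟩

theorem exists_critical_of_deriv_mul_pos {R R' : ℝ → ℝ} {a b : ℝ} (hab : a < b)
    (h : ∀ x ∈ Icc a b, HasDerivWithinAt R (R' x) (Icc a b) x) (hR : R a = R b)
    (hpos : 0 < R' a * R' b) :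
    (∃ x ∈ Icc a b, R' x = 0 ∧ R a ≤ R x) ∧ ∃ x ∈ Icc a b, R' x = 0 ∧ R x ≤ R a := by
  rcases mul_pos_iff.1 hpos with ⟨ha, hb⟩ | ⟨ha, hb⟩
  · exact exists_critical_of_deriv_pos hab h hR ha hb
  · obtain ⟨⟨x, hx, hx0, hxa⟩, ⟨y, hy, hy0, hya⟩⟩ :=
      exists_critical_of_deriv_pos (R := fun x => -R x) (R' := fun x => -R' x) hab
        (fun x hx => (h x hx).neg) (by simp [hR]) (by linarith) (by linarith)
    exact ⟨⟨y, hy, by linarith, by linarith⟩, ⟨x, hx, by linarith, by linarith⟩⟩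

/-- The boosted slope `(A - B p) / √(1 - p²)` determines the slope `p`, if `|A| ≤ B`. -/
theorem boost_injective {A B p q : ℝ} (hB : 0 < B) (hAB : |A| ≤ B) (hp : 0 < 1 - p ^ 2)
    (hq : 0 < 1 - q ^ 2)
    (h : (A - B * p) / √(1 - p ^ 2) = (A - B * q) / √(1 - q ^ 2)) : p = q := by
  have hd : ∀ p ∈ Ioo (-1 : ℝ) 1, HasDerivAt (fun p => (A - B * p) / √(1 - p ^ 2))
      ((A * p - B) / √(1 - p ^ 2) ^ 3) p := by
    intro p hp
    have hs : 0 < 1 - p ^ 2 := by nlinarith [hp.1, hp.2]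
    have hs' := Real.sqrt_pos.2 hs
    have h1 : HasDerivAt (fun p : ℝ => 1 - p ^ 2) (-(2 * p)) p := by
      simpa using (hasDerivAt_pow 2 p).const_sub 1
    have h2 : HasDerivAt (fun p : ℝ => A - B * p) (-B) p := by
      simpa using ((hasDerivAt_id p).const_mul B).const_sub A
    refine (h2.div (h1.sqrt hs.ne') hs'.ne').congr_deriv ?_
    have hsq := Real.sq_sqrt hs.le
    field_simp
    rw [hsq]
    ring
  have hanti : StrictAntiOn (fun p => (A - B * p) / √(1 - p ^ 2)) (Ioo (-1 : ℝ) 1) := by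
    refine strictAntiOn_of_deriv_neg (convex_Ioo _ _)
      (fun p hp => (hd p hp).continuousAt.continuousWithinAt) ?_
    intro p hp
    rw [interior_Ioo] at hp
    rw [(hd p hp).deriv]
    have hs : 0 < 1 - p ^ 2 := by nlinarith [hp.1, hp.2]
    refine div_neg_of_neg_of_pos ?_ (pow_pos (Real.sqrt_pos.2 hs) 3)
    have h1 : |p| < 1 := abs_lt.2 hp
    have h2 : A * p ≤ |A| * |p| := by rw [← abs_mul]; exact le_abs_self _
    nlinarith [abs_nonneg p, abs_nonneg A]
  have mem : ∀ p : ℝ, 0 < 1 - p ^ 2 → p ∈ Ioo (-1 : ℝ) 1 := fun p hp =>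
    abs_lt.1 ((sq_lt_one_iff_abs_lt_one p).1 (by linarith))
  exact hanti.injOn (mem p hp) (mem q hq) h

/-- Lorentz invariance: `(T - X p)² - (X - T p)² = (T² - X²)(1 - p²)`. -/
theorem boost_sq {X T p : ℝ} (hp : 0 < 1 - p ^ 2) :
    ((T - X * p) / √(1 - p ^ 2)) ^ 2 = T ^ 2 - X ^ 2 + ((X - T * p) / √(1 - p ^ 2)) ^ 2 := by
  rw [div_pow, div_pow, Real.sq_sqrt hp.le]
  field_simp
  ring

/-- `r ↦ √(r³ (2M - r)) - H r³` is a concave function of `r³`; in particular its superlevel sets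
are intervals. -/
theorem potential_quasiconcave {M H a x b c : ℝ} (ha : 0 ≤ a) (hax : a ≤ x) (hxb : x ≤ b)
    (hb : b ≤ 2 * M) (hca : c ≤ √(a ^ 3 * (2 * M - a)) - H * a ^ 3)
    (hcb : c ≤ √(b ^ 3 * (2 * M - b)) - H * b ^ 3) :
    c ≤ √(x ^ 3 * (2 * M - x)) - H * x ^ 3 := by
  have hx : 0 ≤ x := ha.trans hax
  have hb0 : 0 ≤ b := hx.trans hxb
  have hmem : x ^ 3 ∈ segment ℝ (a ^ 3) (b ^ 3) := by
    rw [segment_eq_Icc (by gcongr; linarith)]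
    constructor <;> gcongr
  obtain ⟨s, t, hs, ht, hst, hxe⟩ := hmem
  simp only [smul_eq_mul] at hxe
  -- In the variable `u = y³` this is the tangent line inequality at `x³` for the convex function `u
  -- ^ (4/3)`.
  have tangent : ∀ y, 0 ≤ y → 4 * x * y ^ 3 ≤ 3 * y ^ 4 + x ^ 4 := by
    intro y hy
    have : 0 ≤ (y - x) ^ 2 * (3 * y ^ 2 + 2 * y * x + x ^ 2) := by positivity
    nlinarith
  have hquart : x ^ 4 ≤ s * a ^ 4 + t * b ^ 4 := by
    have h1 := mul_le_mul_of_nonneg_left (tangent a ha) hs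
    have h2 := mul_le_mul_of_nonneg_left (tangent b hb0) ht
    have h3 : s * x ^ 4 + t * x ^ 4 = x ^ 4 := by rw [← add_mul, hst, one_mul]
    have h4 : 4 * x * (s * a ^ 3 + t * b ^ 3) = 4 * x ^ 4 := by rw [hxe]; ring
    linarith
  have hle : s * (a ^ 3 * (2 * M - a)) + t * (b ^ 3 * (2 * M - b)) ≤ x ^ 3 * (2 * M - x) := by
    have : x ^ 3 * (2 * M - x) = 2 * M * (s * a ^ 3 + t * b ^ 3) - x ^ 4 := by rw [hxe]; ring
    rw [this]
    linarith
  have hconc := Real.strictConcaveOn_sqrt.concaveOn.2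
    (x := a ^ 3 * (2 * M - a)) (y := b ^ 3 * (2 * M - b))
    (mul_nonneg (pow_nonneg ha 3) (by linarith)) (mul_nonneg (pow_nonneg hb0 3) (by linarith))
    hs ht hst
  simp only [smul_eq_mul] at hconc
  have hsqrt := hconc.trans (Real.sqrt_le_sqrt hle)
  have h1 := mul_le_mul_of_nonneg_left hca hs
  have h2 := mul_le_mul_of_nonneg_left hcb ht
  have h3 : s * c + t * c = c := by rw [← add_mul, hst, one_mul]
  have h4 : H * (s * a ^ 3 + t * b ^ 3) = H * x ^ 3 := by rw [hxe]
  linarith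

end Calculus

/-! ### Regularity and symmetries of the area radius and of the equation -/

section Radius

theorem hasStrictDerivAt_radialFun {M : ℝ} (hM : 0 < M) (r : ℝ) :
    HasStrictDerivAt (radialFun M) (r / (2 * M) * Real.exp (r / (2 * M))) r := by
  have h1 : HasStrictDerivAt (fun r : ℝ => r - 2 * M) 1 r := (hasStrictDerivAt_id r).sub_const _
  have h2 : HasStrictDerivAt (fun r : ℝ => Real.exp (r / (2 * M)))
      (Real.exp (r / (2 * M)) * (1 / (2 * M))) r := by
    simpa [div_eq_mul_inv] using ((hasStrictDerivAt_id r).mul_const (2 * M)⁻¹).exp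
  refine (h1.mul h2).congr_deriv ?_
  field_simp
  ring

/-- The inverse of `radialFun M` on the positive reals. -/
noncomputable def radialInv (M : ℝ) : ℝ → ℝ := Function.invFunOn (radialFun M) (Ioi 0)

theorem radius_eq_radialInv {M T X : ℝ} (hM : 0 < M) (h : -(2 * M) < X ^ 2 - T ^ 2) :
    radius M T X = radialInv M (X ^ 2 - T ^ 2) := by
  have he : ∃ r ∈ Ioi (0 : ℝ), radialFun M r = X ^ 2 - T ^ 2 := (existsUnique_radius hM h).exists
  exact radius_eq hM h (Function.invFunOn_mem he) (Function.invFunOn_eq he)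

theorem radialInv_radialFun {M r : ℝ} (hM : 0 < M) (hr : 0 < r) :
    radialInv M (radialFun M r) = r :=
  (((radialFun_strictMonoOn hM).mono Ioi_subset_Ici_self).injOn.leftInvOn_invFunOn) hr

theorem hasStrictDerivAt_radialInv {M r : ℝ} (hM : 0 < M) (hr : 0 < r) :
    HasStrictDerivAt (radialInv M) (r / (2 * M) * Real.exp (r / (2 * M)))⁻¹ (radialFun M r) := by
  refine (hasStrictDerivAt_radialFun hM r).to_local_left_inverse (by positivity) ?_
  filter_upwards [lt_mem_nhds hr] with x hx using radialInv_radialFun hM hx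

/-- The inverse function rule writes the derivative as a continuous function of `radialInv` itself,
finite because `r > 0`. -/
theorem contDiffAt_radialInv {M y : ℝ} (hM : 0 < M) (hy : -(2 * M) < y) :
    ContDiffAt ℝ 1 (radialInv M) y := by
  have hd : ∀ y, -(2 * M) < y → 0 < radialInv M y ∧ HasStrictDerivAt (radialInv M)
      (radialInv M y / (2 * M) * Real.exp (radialInv M y / (2 * M)))⁻¹ y := by
    intro y hy
    obtain ⟨r, ⟨hr, rfl⟩, -⟩ := existsUnique_radius hM hy
    rw [radialInv_radialFun hM hr]
    exact ⟨hr, hasStrictDerivAt_radialInv hM hr⟩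
  have hU : Ioi (-(2 * M)) ∈ 𝓝 y := Ioi_mem_nhds hy
  refine ContDiffOn.contDiffAt ?_ hU
  rw [show (1 : WithTop ℕ∞) = 0 + 1 from rfl, contDiffOn_succ_iff_deriv_of_isOpen isOpen_Ioi]
  refine ⟨fun y hy => (hd y hy).2.hasDerivAt.differentiableAt.differentiableWithinAt, by simp, ?_⟩
  rw [contDiffOn_zero]
  have hc : ContinuousOn (radialInv M) (Ioi (-(2 * M))) :=
    fun y hy => (hd y hy).2.hasDerivAt.continuousAt.continuousWithinAt
  refine ContinuousOn.congr (f := fun y =>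
    (radialInv M y / (2 * M) * Real.exp (radialInv M y / (2 * M)))⁻¹) ?_
    fun y hy => (hd y hy).2.hasDerivAt.deriv
  refine ContinuousOn.inv₀ (by fun_prop) fun y hy => ?_
  have := (hd y hy).1
  positivity

theorem contDiffAt_radius {M T X : ℝ} (hM : 0 < M) (h : -(2 * M) < X ^ 2 - T ^ 2) :
    ContDiffAt ℝ 1 (fun z : ℝ × ℝ => radius M z.1 z.2) (T, X) := by
  have h1 : ContDiffAt ℝ 1 (fun z : ℝ × ℝ => radialInv M (z.2 ^ 2 - z.1 ^ 2)) (T, X) :=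
    (contDiffAt_radialInv hM h).comp (T, X) (f := fun z : ℝ × ℝ => z.2 ^ 2 - z.1 ^ 2)
      (by fun_prop)
  refine h1.congr_of_eventuallyEq ?_
  have hc : ContinuousAt (fun z : ℝ × ℝ => z.2 ^ 2 - z.1 ^ 2) (T, X) := by fun_prop
  filter_upwards [hc.eventually (lt_mem_nhds h)] with z hz using radius_eq_radialInv hM hz

theorem radius_neg_left (M T X : ℝ) : radius M (-T) X = radius M T X := by
  unfold radius
  rw [neg_sq]

theorem radius_neg_right (M T X : ℝ) : radius M T (-X) = radius M T X := by
  unfold radius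
  rw [neg_sq]

theorem cmcExpr_neg (M H X T p q : ℝ) :
    cmcExpr M (-H) X (-T) (-p) (-q) = -cmcExpr M H X T p q := by
  simp only [cmcExpr, radius_neg_left, neg_sq]
  ring

theorem cmcExpr_reflect (M H X T p q : ℝ) :
    cmcExpr M H (-X) T (-p) q = cmcExpr M H X T p q := by
  simp only [cmcExpr, radius_neg_right, neg_sq, neg_mul_neg]

theorem contDiffAt_cmcExpr {M H X T p : ℝ} (hM : 0 < M) (h : -(2 * M) < X ^ 2 - T ^ 2)
    (hp : 0 < 1 - p ^ 2) :
    ContDiffAt ℝ 1 (fun z : ℝ × ℝ × ℝ => cmcExpr M H z.1 z.2.1 z.2.2 0) (X, T, p) := by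
  have hr : ContDiffAt ℝ 1 (fun z : ℝ × ℝ × ℝ => radius M z.2.1 z.1) (X, T, p) :=
    (contDiffAt_radius hM h).comp (X, T, p) (f := fun z : ℝ × ℝ × ℝ => (z.2.1, z.1)) (by fun_prop)
  have hr0 := (radius_spec hM h).1
  have hs : ContDiffAt ℝ 1 (fun z : ℝ × ℝ × ℝ => √(radius M z.2.1 z.1)) (X, T, p) :=
    hr.sqrt hr0.ne'
  have hw : ContDiffAt ℝ 1 (fun z : ℝ × ℝ × ℝ => (1 - z.2.2 ^ 2) ^ (3 / 2 : ℝ)) (X, T, p) :=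
    ContDiffAt.rpow_const_of_ne (by fun_prop) hp.ne'
  have hX : ContDiffAt ℝ 1 (fun z : ℝ × ℝ × ℝ => z.1) (X, T, p) := by fun_prop
  have hT : ContDiffAt ℝ 1 (fun z : ℝ × ℝ × ℝ => z.2.1) (X, T, p) := by fun_prop
  have hP : ContDiffAt ℝ 1 (fun z : ℝ × ℝ × ℝ => z.2.2) (X, T, p) := by fun_prop
  unfold cmcExpr
  refine ContDiffAt.add (ContDiffAt.add contDiffAt_const (ContDiffAt.mul (ContDiffAt.mul
    (ContDiffAt.mul (hr.div_const _).neg.exp (ContDiffAt.sub ?_ ?_)) ?_) ?_)) ?_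
  · exact contDiffAt_const.div (hr.pow 2) (by positivity)
  · exact contDiffAt_const.div hr hr0.ne'
  · exact hT.neg.add (hP.mul hX)
  · exact contDiffAt_const.sub (hP.pow 2)
  · refine ContDiffAt.mul (ContDiffAt.div (contDiffAt_const.mul (hr.div_const _).neg.exp) hs ?_) hw
    exact (Real.sqrt_pos.2 hr0).ne'

end Radius

/-! ### Time reversal, reflection and uniqueness for SS-CMC graphs -/

namespace IsSSCMC

variable {M H : ℝ} {I : Set ℝ} {F : ℝ → ℝ}

theorem uniqueDiffOn (h : IsSSCMC M H I F) : UniqueDiffOn ℝ I :=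
  uniqueDiffOn_convex h.ordConnected.convex
    (h.ordConnected.convex.nontrivial_iff_nonempty_interior.1 h.nontrivial)

theorem hasDerivWithinAt (h : IsSSCMC M H I F) {X : ℝ} (hX : X ∈ I) :
    HasDerivWithinAt F (derivWithin F I X) I X :=
  ((h.contDiffOn.differentiableOn (by norm_num)) X hX).hasDerivWithinAt

theorem hasDerivWithinAt_deriv (h : IsSSCMC M H I F) {X : ℝ} (hX : X ∈ I) :
    HasDerivWithinAt (derivWithin F I) (derivWithin (derivWithin F I) I X) I X := by
  have h1 := h.contDiffOn
  rw [show (2 : WithTop ℕ∞) = 1 + 1 by norm_num,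
    contDiffOn_succ_iff_derivWithin h.uniqueDiffOn] at h1
  exact ((h1.2.2.differentiableOn (by norm_num)) X hX).hasDerivWithinAt

theorem neg (h : IsSSCMC M H I F) : IsSSCMC M (-H) I (-F) := by
  have h1 : derivWithin (-F) I = -derivWithin F I := by
    ext X; simp [derivWithin.neg]
  refine ⟨h.ordConnected, h.nontrivial, h.contDiffOn.neg, fun X hX => ?_, fun X hX => ?_,
    fun X hX => ?_⟩
  · simpa using h.mem_kruskal X hX
  · simpa [h1] using h.spacelike X hX
  · rw [h1, derivWithin.neg]
    simp only [Pi.neg_apply]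
    rw [cmcExpr_neg, h.equation X hX, neg_zero]

theorem derivWithin_reflect (F : ℝ → ℝ) (I : Set ℝ) :
    derivWithin (fun X => F (-X)) (-I) = fun X => -derivWithin F I (-X) := by
  ext X; rw [derivWithin_comp_neg, neg_neg]

theorem reflect (h : IsSSCMC M H I F) : IsSSCMC M H (-I) (fun X => F (-X)) := by
  have h2 : derivWithin (derivWithin (fun X => F (-X)) (-I)) (-I)
      = fun X => derivWithin (derivWithin F I) I (-X) := by
    rw [derivWithin_reflect]
    ext X
    rw [derivWithin.fun_neg, derivWithin_comp_neg, neg_neg, neg_neg]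
  refine ⟨?_, ?_, ?_, fun X hX => ?_, fun X hX => ?_, fun X hX => ?_⟩
  · exact (h.ordConnected.convex.neg).ordConnected
  · obtain ⟨x, hx, y, hy, hxy⟩ := h.nontrivial
    exact ⟨-x, by simpa, -y, by simpa, by simpa⟩
  · exact h.contDiffOn.comp contDiff_neg.contDiffOn fun X hX => hX
  · simpa using h.mem_kruskal (-X) hX
  · simpa [derivWithin_reflect] using h.spacelike (-X) hX
  · rw [h2, derivWithin_reflect]
    have := h.equation (-X) hX
    rwa [← cmcExpr_reflect, neg_neg] at this

/-- Two graphs of the same mean curvature with a common point and slope agree. -/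
theorem eqOn_Icc {J : Set ℝ} {G : ℝ → ℝ} (hM : 0 < M) (hF : IsSSCMC M H I F)
    (hG : IsSSCMC M H J G) {a b t : ℝ} (ht : t = a ∨ t = b)
    (hI : Icc a b ⊆ I) (hJ : Icc a b ⊆ J)
    (h0 : F t = G t) (h1 : derivWithin F I t = derivWithin G J t) : EqOn F G (Icc a b) := by
  -- `cmcExpr` is `q` plus terms free of `q`, so its value at `q = 0` is minus the second
  -- derivative.
  have solve : ∀ {I : Set ℝ} {F : ℝ → ℝ}, IsSSCMC M H I F → ∀ X ∈ I,
      derivWithin (derivWithin F I) I X = -cmcExpr M H X (F X) (derivWithin F I X) 0 := by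
    intro I F hF X hX
    have := hF.equation X hX
    unfold cmcExpr at this ⊢
    linarith
  refine eqOn_of_secondOrder (Φ := fun z => -cmcExpr M H z.1 z.2.1 z.2.2 0) ht
    (fun x hx => (hF.hasDerivWithinAt (hI hx)).mono hI) (fun x hx => ?_)
    (fun x hx => (hG.hasDerivWithinAt (hJ hx)).mono hJ) (fun x hx => ?_)
    (fun x hx => ?_) (fun x hx => ?_) h0 h1
  · rw [← solve hF x (hI hx)]
    exact (hF.hasDerivWithinAt_deriv (hI hx)).mono hI
  · rw [← solve hG x (hJ hx)]
    exact (hG.hasDerivWithinAt_deriv (hJ hx)).mono hJ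
  · exact (contDiffAt_cmcExpr hM (hF.mem_kruskal x (hI hx)) (hF.spacelike x (hI hx))).neg
  · exact (contDiffAt_cmcExpr hM (hG.mem_kruskal x (hJ hx)) (hG.spacelike x (hJ hx))).neg

end IsSSCMC

/-! ### Conservation of the flux -/

/-- The first integral of the constant mean curvature equation that belongs to the Killing field
`X ∂_T + T ∂_X`. -/
noncomputable def flux (M H X T p : ℝ) : ℝ :=
  √(radius M T X) * radius M T X * Real.exp (-(radius M T X / (4 * M)))
      * ((T - X * p) / √(1 - p ^ 2)) - H * radius M T X ^ 3

theorem flux_reflect (M H X T p : ℝ) : flux M H (-X) T (-p) = flux M H X T p := by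
  simp only [flux, radius_neg_right, neg_mul_neg, neg_sq]

theorem exp_half_eq_sq (M r : ℝ) :
    Real.exp (-(r / (2 * M))) = Real.exp (-(r / (4 * M))) ^ 2 := by
  rw [← Real.exp_nat_mul]
  congr 1
  push_cast
  ring

namespace IsSSCMC

variable {M H : ℝ} {I : Set ℝ} {F : ℝ → ℝ}

theorem hasDerivWithinAt_radius (hM : 0 < M) (h : IsSSCMC M H I F) {X : ℝ} (hX : X ∈ I) :
    HasDerivWithinAt (fun X => radius M (F X) X)
      (4 * M * Real.exp (-(radius M (F X) X / (4 * M))) ^ 2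
        * (X - F X * derivWithin F I X) / radius M (F X) X) I X := by
  obtain ⟨hr, hre⟩ := radius_spec hM (h.mem_kruskal X hX)
  have h1 : HasDerivWithinAt (fun X => X ^ 2 - F X ^ 2)
      (2 * X - 2 * F X * derivWithin F I X) I X := by
    refine (((hasDerivAt_pow 2 X).hasDerivWithinAt).sub
      ((h.hasDerivWithinAt hX).pow 2)).congr_deriv ?_
    simp
  have h2 := (hasStrictDerivAt_radialInv hM hr).hasDerivAt
  rw [hre] at h2
  have h3 := h2.comp_hasDerivWithinAt X h1
  refine (h3.congr (fun Y hY => radius_eq_radialInv hM (h.mem_kruskal Y hY))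
    (radius_eq_radialInv hM (h.mem_kruskal X hX))).congr_deriv ?_
  rw [← exp_half_eq_sq, Real.exp_neg]
  field_simp
  ring

theorem hasDerivWithinAt_boost (h : IsSSCMC M H I F) {X : ℝ} (hX : X ∈ I) :
    HasDerivWithinAt (fun X => (F X - X * derivWithin F I X) / √(1 - derivWithin F I X ^ 2))
      (derivWithin (derivWithin F I) I X * (F X * derivWithin F I X - X)
        / √(1 - derivWithin F I X ^ 2) ^ 3) I X := by
  have hp := h.spacelike X hX
  have hs := Real.sqrt_pos.2 hp
  have hsq := Real.sq_sqrt hp.le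
  have hd := h.hasDerivWithinAt_deriv hX
  have h1 := (h.hasDerivWithinAt hX).sub ((hasDerivWithinAt_id X I).mul hd)
  have h2 := ((hd.pow 2).const_sub 1).sqrt hp.ne'
  refine (h1.div h2 hs.ne').congr_deriv ?_
  simp only [Pi.sub_apply, Pi.mul_apply, id, Pi.pow_apply]
  field_simp
  rw [hsq]
  ring

/-- The derivatives of the radius and of the boosted slope share the factor `X - F F'` up to sign.
The cofactor in the derivative of the flux is a multiple of the equation. -/
theorem hasDerivWithinAt_flux (hM : 0 < M) (h : IsSSCMC M H I F) {X : ℝ} (hX : X ∈ I) :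
    HasDerivWithinAt (fun X => flux M H X (F X) (derivWithin F I X)) 0 I X := by
  have hr := (radius_spec hM (h.mem_kruskal X hX)).1
  have hp := h.spacelike X hX
  have hrd := h.hasDerivWithinAt_radius hM hX
  have hw := hrd.sqrt hr.ne'
  have hE := (hrd.div_const (4 * M)).neg.exp
  have hB := h.hasDerivWithinAt_boost hX
  have heq := h.equation X hX
  refine (((((hw.mul hrd).mul hE).mul hB)).sub ((hrd.pow 3).const_mul H)).congr_deriv ?_
  have hrpow : (1 - derivWithin F I X ^ 2) ^ (3 / 2 : ℝ) = √(1 - derivWithin F I X ^ 2) ^ 3 := by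
    rw [Real.sqrt_eq_rpow, ← Real.rpow_natCast _ 3, ← Real.rpow_mul hp.le]
    norm_num
  simp only [cmcExpr, hrpow, exp_half_eq_sq] at heq
  simp only [Pi.mul_apply, Pi.neg_apply]
  set r := radius M (F X) X with hrdef
  set p := derivWithin F I X
  set q := derivWithin (derivWithin F I) I X
  have hs := Real.sqrt_pos.2 hp
  have hsq := Real.sq_sqrt hp.le
  set s := √(1 - p ^ 2)
  have hw0 := Real.sqrt_pos.2 hr
  have hwsq := Real.sq_sqrt hr.le
  set w := √r
  set E := Real.exp (-(r / (4 * M)))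
  rw [← hsq] at heq
  have hq : q = -(E ^ 2 * (6 * M / r ^ 2 - 1 / r) * (-F X + p * X) * s ^ 2
      + 12 * H * M * E / w * s ^ 3) := by linarith
  rw [hq, ← hwsq]
  field_simp
  ring

theorem flux_eq (hM : 0 < M) (h : IsSSCMC M H I F) {X Y : ℝ} (hX : X ∈ I) (hY : Y ∈ I) :
    flux M H X (F X) (derivWithin F I X) = flux M H Y (F Y) (derivWithin F I Y) := by
  wlog hXY : X ≤ Y generalizing X Y
  · exact (this hY hX (le_of_not_ge hXY)).symm
  have hsub : Icc X Y ⊆ I := h.ordConnected.out hX hY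
  rcases hXY.eq_or_lt with rfl | hlt
  · rfl
  have hd : ∀ Z ∈ Icc X Y, HasDerivWithinAt (fun X => flux M H X (F X) (derivWithin F I X)) 0
      (Icc X Y) Z := fun Z hZ => (h.hasDerivWithinAt_flux hM (hsub hZ)).mono hsub
  exact (constant_of_derivWithin_zero (fun Z hZ => (hd Z hZ).differentiableWithinAt)
    (fun Z hZ => (hd Z (Ico_subset_Icc_self hZ)).derivWithin
      (uniqueDiffOn_Icc hlt Z (Ico_subset_Icc_self hZ))) Y (right_mem_Icc.2 hXY)).symm

/-- Between two points of the region `|X| < T` that are symmetric to each other a spacelike graph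
stays in this region. -/
theorem abs_lt_of_mem_Icc (h : IsSSCMC M H I F) {a X : ℝ} (ha : a ∈ I) (ha' : -a ∈ I)
    (hFa : a < F a) (hsymm : F (-a) = F a) (hX : X ∈ Icc (-a) a) : |X| < F X := by
  have hsub : Icc (-a) a ⊆ I := h.ordConnected.out ha' ha
  have haa : -a ≤ a := hX.1.trans hX.2
  have hlip : ∀ {x y : ℝ}, x ∈ Icc (-a) a → y ∈ Icc (-a) a → |F y - F x| ≤ |y - x| := by
    intro x y hx hy
    have := (convex_Icc (-a) a).norm_image_sub_le_of_norm_hasDerivWithin_le (C := 1)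
      (fun z hz => (h.hasDerivWithinAt (hsub hz)).mono hsub) (fun z hz => ?_) hx hy
    · simpa using this
    · exact (abs_lt.2 (abs_lt.1 ((sq_lt_one_iff_abs_lt_one _).1
        (by linarith [h.spacelike z (hsub hz)])))).le
  -- The 1-Lipschitz bound from `a` gives `F X > X`, the one from `-a` gives `F X > -X`.
  have h1 := hlip hX (right_mem_Icc.2 haa)
  have h2 := hlip hX (left_mem_Icc.2 haa)
  rw [abs_of_nonneg (by linarith [hX.2] : (0 : ℝ) ≤ a - X)] at h1
  rw [abs_of_nonpos (by linarith [hX.1] : -a - X ≤ (0 : ℝ)), hsymm] at h2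
  rw [abs_lt]
  constructor <;> linarith [(abs_le.1 h1).2, (abs_le.1 h2).2]

end IsSSCMC

/-! ### Comparison of the flux with the potential -/

theorem potential_eq {M T X : ℝ} (hM : 0 < M) (h : -(2 * M) < X ^ 2 - T ^ 2) :
    √(radius M T X ^ 3 * (2 * M - radius M T X))
      = √(radius M T X) * radius M T X * Real.exp (-(radius M T X / (4 * M)))
        * √(T ^ 2 - X ^ 2) := by
  obtain ⟨hr, hre⟩ := radius_spec hM h
  set r := radius M T X
  have h1 : r ^ 3 * (2 * M - r)
      = r * (r * Real.exp (-(r / (4 * M)))) ^ 2 * (T ^ 2 - X ^ 2) := by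
    have : T ^ 2 - X ^ 2 = (2 * M - r) * Real.exp (r / (2 * M)) := by
      rw [radialFun] at hre; linarith
    rw [this, mul_pow, ← exp_half_eq_sq, Real.exp_neg]
    field_simp
  rw [h1, Real.sqrt_mul (by positivity), Real.sqrt_mul hr.le, Real.sqrt_sq (by positivity)]
  ring

theorem potential_eq_flux {M H T X p : ℝ} (hM : 0 < M) (h : -(2 * M) < X ^ 2 - T ^ 2)
    (hp : 0 < 1 - p ^ 2) (hpos : 0 ≤ T - X * p) (hcrit : X - T * p = 0) :
    flux M H X T p = √(radius M T X ^ 3 * (2 * M - radius M T X)) - H * radius M T X ^ 3 := by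
  have h1 := boost_sq (X := X) (T := T) hp
  rw [hcrit, zero_div, zero_pow two_ne_zero, add_zero] at h1
  rw [potential_eq hM h, ← h1, Real.sqrt_sq (by positivity), flux]

/-- By `boost_sq` the boosted slope exceeds `√(T² - X²)` as soon as the radius is not critical. -/
theorem potential_lt_flux {M H T X p : ℝ} (hM : 0 < M) (h : -(2 * M) < X ^ 2 - T ^ 2)
    (hp : 0 < 1 - p ^ 2) (hpos : 0 < T - X * p) (hcrit : X - T * p ≠ 0) :
    √(radius M T X ^ 3 * (2 * M - radius M T X)) - H * radius M T X ^ 3 < flux M H X T p := by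
  have h1 := boost_sq (X := X) (T := T) hp
  have hs := Real.sqrt_pos.2 hp
  have hr := (radius_spec hM h).1
  have h2 : 0 < ((X - T * p) / √(1 - p ^ 2)) ^ 2 := by positivity
  have h3 : √(T ^ 2 - X ^ 2) < (T - X * p) / √(1 - p ^ 2) :=
    (Real.sqrt_lt' (by positivity)).2 (by linarith)
  rw [potential_eq hM h, flux]
  gcongr

theorem radius_le_of_le {M T X T' X' : ℝ} (hM : 0 < M) (h : -(2 * M) < X ^ 2 - T ^ 2)
    (hle : X ^ 2 - T ^ 2 ≤ X' ^ 2 - T' ^ 2) : radius M T X ≤ radius M T' X' := by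
  obtain ⟨hr, hre⟩ := radius_spec hM h
  obtain ⟨hr', hre'⟩ := radius_spec hM (h.trans_le hle)
  rw [← (radialFun_strictMonoOn hM).le_iff_le hr.le hr'.le, hre, hre']
  exact hle

theorem radius_le_two_mul {M T X : ℝ} (hM : 0 < M) (h : -(2 * M) < X ^ 2 - T ^ 2)
    (hle : X ^ 2 - T ^ 2 ≤ 0) : radius M T X ≤ 2 * M := by
  obtain ⟨hr, hre⟩ := radius_spec hM h
  have h2 : radialFun M (2 * M) = 0 := by simp [radialFun]
  rw [← (radialFun_strictMonoOn hM).le_iff_le hr.le (mem_Ici.2 (by positivity)), hre, h2]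
  exact hle

/-! ### Opposite slopes at symmetric points -/

namespace IsSSCMC

variable {M H : ℝ} {I : Set ℝ} {F : ℝ → ℝ}

/-- In the region `|X| < T` the area radius cannot be increasing, or decreasing, at both of two
symmetric points of equal height. -/
theorem mul_nonpos_of_lt (hM : 0 < M) (h : IsSSCMC M H I F) {a : ℝ} (ha0 : 0 < a) (ha : a ∈ I)
    (ha' : -a ∈ I) (hFa : a < F a) (hsymm : F (-a) = F a) :
    (-a - F a * derivWithin F I (-a)) * (a - F a * derivWithin F I a) ≤ 0 := by
  by_contra! hpos
  have hsub : Icc (-a) a ⊆ I := h.ordConnected.out ha' ha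
  -- `X² - F²` replaces `r`, of which it is an increasing function.
  have hR : ∀ x ∈ Icc (-a) a, HasDerivWithinAt (fun X => X ^ 2 - F X ^ 2)
      (2 * (x - F x * derivWithin F I x)) (Icc (-a) a) x := by
    intro x hx
    have := (((hasDerivAt_pow 2 x).hasDerivWithinAt).sub
      ((h.hasDerivWithinAt (hsub hx)).pow 2)).mono hsub
    refine this.congr_deriv ?_
    simp
    ring
  obtain ⟨⟨y, hy, hy0, hay⟩, ⟨x, hx, hx0, hxa⟩⟩ :=
    exists_critical_of_deriv_mul_pos (by linarith) hR (by simp [hsymm])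
      (by rw [hsymm]; nlinarith)
  simp only [neg_sq, hsymm] at hay hxa
  have hin := fun {X} hX => h.abs_lt_of_mem_Icc (X := X) ha ha' hFa hsymm hX
  have hk := fun {X} (hX : X ∈ Icc (-a) a) => h.mem_kruskal X (hsub hX)
  have hsp := fun {X} (hX : X ∈ Icc (-a) a) => h.spacelike X (hsub hX)
  have hpos' : ∀ X ∈ Icc (-a) a, 0 < F X - X * derivWithin F I X := by
    intro X hX
    have h1 : |derivWithin F I X| < 1 :=
      (sq_lt_one_iff_abs_lt_one _).1 (by linarith [hsp hX])
    have h2 : X * derivWithin F I X ≤ |X| * |derivWithin F I X| := by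
      rw [← abs_mul]; exact le_abs_self _
    nlinarith [hin hX, abs_nonneg X]
  have haI : a ∈ Icc (-a) a := right_mem_Icc.2 (by linarith)
  have hlt := potential_lt_flux (H := H) hM (hk haI) (hsp haI) (hpos' a haI)
    (right_ne_zero_of_mul hpos.ne')
  have hcx := potential_eq_flux (H := H) hM (hk hx) (hsp hx) (hpos' x hx).le (by linarith)
  have hcy := potential_eq_flux (H := H) hM (hk hy) (hsp hy) (hpos' y hy).le (by linarith)
  -- The critical points have `V` equal to the conserved flux and radii on either side of `r(a)`,
  -- which forces `V(r(a))` to be at least the flux.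
  refine absurd (potential_quasiconcave (radius_spec hM (hk hx)).1.le
    (radius_le_of_le hM (hk hx) hxa) (radius_le_of_le hM (hk haI) hay)
    (radius_le_two_mul hM (hk hy) ?_) ?_ ?_) (not_le.2 hlt)
  · have := sq_lt_sq' (by linarith [(abs_lt.1 (hin hy)).1]) (abs_lt.1 (hin hy)).2
    linarith
  · rw [← hcx, h.flux_eq hM ha (hsub hx)]
  · rw [← hcy, h.flux_eq hM ha (hsub hy)]

theorem deriv_neg_eq_of_lt (hM : 0 < M) (h : IsSSCMC M H I F) {a : ℝ} (ha0 : 0 < a) (ha : a ∈ I)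
    (ha' : -a ∈ I) (hFa : a < F a) (hsymm : F (-a) = F a)
    (hb : (F a - a * derivWithin F I a) / √(1 - derivWithin F I a ^ 2)
      = (F a - a * -derivWithin F I (-a)) / √(1 - (-derivWithin F I (-a)) ^ 2)) :
    derivWithin F I a = -derivWithin F I (-a) := by
  have hp := h.spacelike a ha
  have hq : 0 < 1 - (-derivWithin F I (-a)) ^ 2 := by simpa using h.spacelike (-a) ha'
  have hle := h.mul_nonpos_of_lt hM ha0 ha ha' hFa hsymm
  set p := derivWithin F I a
  set q := -derivWithin F I (-a) with hqdef
  rw [show derivWithin F I (-a) = -q by simp [hqdef]] at hle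
  have hsq : ((a - F a * p) / √(1 - p ^ 2)) ^ 2 = ((a - F a * q) / √(1 - q ^ 2)) ^ 2 := by
    have h1 := boost_sq (X := a) (T := F a) hp
    have h2 := boost_sq (X := a) (T := F a) hq
    rw [hb] at h1
    linarith
  refine boost_injective (A := a) (B := F a) (by linarith) (by rw [abs_of_pos ha0]; exact hFa.le)
    hp hq ?_
  have hsp := Real.sqrt_pos.2 hp
  have hsq' := Real.sqrt_pos.2 hq
  have hprod : 0 ≤ ((a - F a * p) / √(1 - p ^ 2)) * ((a - F a * q) / √(1 - q ^ 2)) := by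
    rw [div_mul_div_comm]
    refine div_nonneg ?_ (by positivity)
    linarith
  -- Under opposite signs the nonnegative product is minus a square, so both sides vanish.
  rcases sq_eq_sq_iff_eq_or_eq_neg.1 hsq with h1 | h1
  · exact h1
  · rw [h1] at hprod ⊢
    have : (a - F a * q) / √(1 - q ^ 2) = 0 := by
      nlinarith [sq_nonneg ((a - F a * q) / √(1 - q ^ 2))]
    rw [this, neg_zero]

theorem boost_eq (hM : 0 < M) (h : IsSSCMC M H I F) {a : ℝ} (ha : a ∈ I)
    (ha' : -a ∈ I) (hsymm : F (-a) = F a) :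
    (F a - a * derivWithin F I a) / √(1 - derivWithin F I a ^ 2)
      = (F a - a * -derivWithin F I (-a)) / √(1 - (-derivWithin F I (-a)) ^ 2) := by
  have h1 := h.flux_eq hM ha ha'
  -- Reflecting the flux at `-a` to the point `a` gives both sides the same radius, which then
  -- cancels.
  rw [hsymm, ← flux_reflect M H (-a), neg_neg, flux, flux] at h1
  have hr := (radius_spec hM (h.mem_kruskal a ha)).1
  have hw := Real.sqrt_pos.2 hr
  exact mul_left_cancel₀ (by positivity) (sub_left_injective h1)

/-- At two symmetric points of equal height the slopes are opposite. -/
theorem deriv_neg_eq (hM : 0 < M) (h : IsSSCMC M H I F) {a : ℝ} (ha0 : 0 < a) (ha : a ∈ I)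
    (ha' : -a ∈ I) (hsymm : F (-a) = F a) :
    derivWithin F I a = -derivWithin F I (-a) := by
  have hb := h.boost_eq hM ha ha' hsymm
  rcases le_or_gt |F a| a with hle | hlt
  · exact boost_injective ha0 hle (h.spacelike a ha) (by simpa using h.spacelike (-a) ha') hb
  rcases lt_abs.1 hlt with hlt | hlt
  · exact h.deriv_neg_eq_of_lt hM ha0 ha ha' hlt hsymm hb
  · have := h.neg.deriv_neg_eq_of_lt hM ha0 ha ha' hlt (by simp [hsymm])
      (h.neg.boost_eq hM ha ha' (by simp [hsymm]))
    rw [derivWithin.neg, derivWithin.neg] at this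
    linarith

/-- The mirror image solves the same equation with the same value and slope at `a`; uniqueness
applies on the segment from `a` to `X`. -/
theorem reflect_eq_of_pos (hM : 0 < M) (h : IsSSCMC M H I F) {a : ℝ} (ha0 : 0 < a) (ha : a ∈ I)
    (ha' : -a ∈ I) (hsymm : F (-a) = F a) {X : ℝ} (hX : X ∈ I) (hX' : -X ∈ I) :
    F (-X) = F X := by
  have hd : derivWithin F I a = derivWithin (fun X => F (-X)) (-I) a := by
    rw [derivWithin_reflect, h.deriv_neg_eq hM ha0 ha ha' hsymm]
  have hr := h.reflect
  rcases le_total X a with hle | hle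
  · exact (eqOn_Icc hM h hr (Or.inr rfl) (h.ordConnected.out hX ha)
      (hr.ordConnected.out (by simpa) (by simpa)) hsymm.symm hd (left_mem_Icc.2 hle)).symm
  · exact (eqOn_Icc hM h hr (Or.inl rfl) (h.ordConnected.out ha hX)
      (hr.ordConnected.out (by simpa) (by simpa)) hsymm.symm hd (right_mem_Icc.2 hle)).symm

/-- Being a graph of constant mean curvature is a local property. -/
theorem of_locally {J : Set ℝ} {G : ℝ → ℝ} (hJ : J.OrdConnected) (hJ' : J.Nontrivial)
    (hloc : ∀ X ∈ J, ∃ I F, IsSSCMC M H I F ∧ I =ᶠ[𝓝 X] J ∧ ∀ᶠ Y in 𝓝 X, Y ∈ I → G Y = F Y) :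
    IsSSCMC M H J G := by
  have key : ∀ X ∈ J, ∃ I F, IsSSCMC M H I F ∧ X ∈ I ∧ I =ᶠ[𝓝 X] J ∧ G =ᶠ[𝓝[I] X] F ∧
      G X = F X ∧ derivWithin G J X = derivWithin F I X ∧
      derivWithin (derivWithin G J) J X = derivWithin (derivWithin F I) I X := by
    intro X hX
    obtain ⟨I, F, h, hIJ, hGF⟩ := hloc X hX
    have hXI : X ∈ I := (Eventually.self_of_nhds hIJ.mem_iff).2 hX
    -- Agreement of first derivatives is needed near `X`, not just at `X`, to compare second
    -- derivatives.
    have hev : ∀ᶠ Z in 𝓝 X, Z ∈ I → derivWithin G J Z = derivWithin F I Z := by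
      filter_upwards [hIJ.eventuallyEq_nhds, hGF.eventually_nhds] with Z hZ hZ' hZI
      rw [← derivWithin_congr_set hZ]
      exact EventuallyEq.derivWithin_eq (eventually_nhdsWithin_iff.2 hZ') (hZ'.self_of_nhds hZI)
    refine ⟨I, F, h, hXI, hIJ, eventually_nhdsWithin_iff.2 hGF, hGF.self_of_nhds hXI,
      hev.self_of_nhds hXI, ?_⟩
    rw [← derivWithin_congr_set hIJ]
    exact EventuallyEq.derivWithin_eq (eventually_nhdsWithin_iff.2 hev) (hev.self_of_nhds hXI)
  refine ⟨hJ, hJ', fun X hX => ?_, fun X hX => ?_, fun X hX => ?_, fun X hX => ?_⟩ <;>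
    obtain ⟨I, F, h, hXI, hIJ, hGF, h0, h1, h2⟩ := key X hX
  · rw [← contDiffWithinAt_congr_set hIJ]
    exact (h.contDiffOn X hXI).congr_of_eventuallyEq hGF h0
  · rw [h0]; exact h.mem_kruskal X hXI
  · rw [h1]; exact h.spacelike X hXI
  · rw [h0, h1, h2]; exact h.equation X hXI

end IsSSCMC

/-! ### Gluing a graph to its reflection -/

/-- One of the intervals `I`, `-I` contains the other to the right of `-b`. The glued graph is thus
locally one of the two pieces, and no junction has to be smoothed. -/
theorem mem_iff_mem_union_neg {I : Set ℝ} (hI : I.OrdConnected) {b : ℝ}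
    (hb1 : b ∈ I) (hb2 : -b ∈ I) :
    (∀ Y, -b < Y → (Y ∈ I ↔ Y ∈ I ∪ -I)) ∨ ∀ Y, -b < Y → (Y ∈ -I ↔ Y ∈ I ∪ -I) := by
  by_cases hsub : ∀ Y, -b < Y → -Y ∈ I → Y ∈ I
  · left
    intro Y hY
    exact ⟨Or.inl, fun h => h.elim id (hsub Y hY)⟩
  · right
    push Not at hsub
    obtain ⟨Z, hZ, hZI, hZI'⟩ := hsub
    intro Y hY
    refine ⟨Or.inr, fun h => h.elim (fun hYI => ?_) id⟩
    have hbZ : b < Z := by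
      by_contra! hle
      exact hZI' (hI.out hb2 hb1 ⟨hZ.le, hle⟩)
    have hYZ : Y < Z := by
      by_contra! hle
      exact hZI' (hI.out hb1 hYI ⟨hbZ.le, hle⟩)
    exact hI.out hZI hb1 ⟨by linarith, by linarith⟩

/-- Two graphs that are reflections of each other and agree where both are defined glue together. -/
theorem IsSSCMC.union_reflect {M H : ℝ} {I : Set ℝ} {F : ℝ → ℝ} (h : IsSSCMC M H I F) {b : ℝ}
    (hb : 0 < b) (hb1 : b ∈ I) (hb2 : -b ∈ I) {G : ℝ → ℝ} (hG : EqOn G F I)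
    (hG' : EqOn G (fun X => F (-X)) (-I)) :
    IsSSCMC M H (I ∪ -I) G := by
  have hJ : (I ∪ -I).OrdConnected := by
    refine (h.ordConnected.isPreconnected.union b hb1 (by simpa)
      h.reflect.ordConnected.isPreconnected).ordConnected
  have hpos : ∀ X, -b < X → ∃ I' F', IsSSCMC M H I' F' ∧ I' =ᶠ[𝓝 X] (I ∪ -I : Set ℝ) ∧
      ∀ᶠ Y in 𝓝 X, Y ∈ I' → G Y = F' Y := by
    intro X hX
    rcases mem_iff_mem_union_neg h.ordConnected hb1 hb2 with hu | hu
    · refine ⟨I, F, h, ?_, Eventually.of_forall fun Y hY => hG hY⟩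
      filter_upwards [lt_mem_nhds hX] with Y hY using propext (hu Y hY)
    · refine ⟨-I, _, h.reflect, ?_, Eventually.of_forall fun Y hY => hG' hY⟩
      filter_upwards [lt_mem_nhds hX] with Y hY using propext (hu Y hY)
  refine IsSSCMC.of_locally hJ (h.nontrivial.mono subset_union_left) fun X _ => ?_
  -- Since `b > 0`, a point `X ≤ -b` has `-X > -b`, so reflection reduces it to the first case.
  rcases lt_or_ge (-b) X with hX | hX
  · exact hpos X hX
  · obtain ⟨I', F', h', hI', hF'⟩ := hpos (-X) (by linarith)
    refine ⟨-I', _, h'.reflect, ?_, ?_⟩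
    · have := (continuous_neg.tendsto X).eventually hI'
      filter_upwards [this] with Y hY
      have hY' : (-Y ∈ I' ↔ -Y ∈ I ∪ -I) := iff_of_eq hY
      have hu : -Y ∈ I ∪ -I ↔ Y ∈ I ∪ -I := by simp [or_comm]
      exact propext (hY'.trans hu)
    · filter_upwards [(continuous_neg.tendsto X).eventually hF',
        (continuous_neg.tendsto X).eventually hI'] with Y hY hYI hYI'
      have hY' : -Y ∈ I ∪ -I := (iff_of_eq hYI).1 hYI'
      rw [← hY hYI']
      rcases hY' with h1 | h1
      · rw [hG h1, hG' (by simpa using h1)]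
      · rw [hG' h1, hG (by simpa using h1)]
        simp

end Kruskal

theorem mainTheorem3 (M : ℝ) (hM : 0 < M) (H T₀ X₀ : ℝ) (hX₀ : X₀ ≠ 0)
    (I : Set ℝ) (F : ℝ → ℝ) (hF : Kruskal.SolvesDirichlet M H T₀ X₀ I F) :
    (∀ X ∈ I, -X ∈ I → F (-X) = F X) ∧
      (Kruskal.IsInextendible M H I F → Kruskal.IsTAxisymmetric I F) := by
  classical
  obtain ⟨b, hb, hb1, hb2, hbF⟩ : ∃ b, 0 < b ∧ b ∈ I ∧ -b ∈ I ∧ F (-b) = F b := by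
    have h : F (-X₀) = F X₀ := hF.left_value.trans hF.right_value.symm
    rcases lt_or_gt_of_ne hX₀ with h0 | h0
    · exact ⟨-X₀, by linarith, hF.mem_left, by simpa using hF.mem_right, by simpa using h.symm⟩
    · exact ⟨X₀, h0, hF.mem_right, hF.mem_left, h⟩
  have hsymm : ∀ X ∈ I, -X ∈ I → F (-X) = F X := fun X hX hX' =>
    hF.isSSCMC.reflect_eq_of_pos hM hb hb1 hb2 hbF hX hX'
  refine ⟨hsymm, fun hmax X hX => ?_⟩
  have hJ := hmax.2 (I ∪ -I) (fun X => if X ∈ I then F X else F (-X))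
    (hF.isSSCMC.union_reflect hb hb1 hb2 (fun X hX => if_pos hX) fun X hX => by
      by_cases h : X ∈ I
      · exact (if_pos h).trans (hsymm X h hX).symm
      · exact if_neg h)
    subset_union_left fun X hX => if_pos hX
  have hX' : -X ∈ I := by
    rw [← hJ]
    exact Or.inr (by simpa using hX)
  exact ⟨hX', hsymm X hX hX'⟩
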